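/- Let $m$ be Lebesgue measure on $\mathbb{R}$, write $m(f)=\int_{\mathbb{R}} f\,dm$, and let $T:\mathbb{R}\to\mathbb{R}$ be the Boole map $T(x)=x-\frac1x$ for $x\neq 0$ (with $T(0)=0$, the value at this one point being immaterial). Then $T$ is global-local mixing: let $F\in L^\infty(m)$ and $g\in L^1(m)$ be real- or complex-valued, and suppose that the infinite-volume average $$\overline{m}(F):=\lim_{a\to+\infty}\frac1{2a}\int_{-a}^{a}F\,dm$$ exists. Then $(F\circ T^n)\,g\in L^1(m)$ for every $n\ge 0$, where $T^n$ is the $n$-th iterate of $T$, and $$\lim_{n\to\infty} m\big((F\circ T^n)\,g\big)=\overline{m}(F)\,m(g).$$ -/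

import Mathlib

open MeasureTheory Filter Topology

/-- The Boole map `x ↦ x - 1 / x` of the real line. At the single point `0`, where the formula
has no meaning, the value is `0`. -/
noncomputable def booleMap (x : ℝ) : ℝ := x - 1 / x

/-- `F` has infinite-volume average `c`: the limit of `(1 / (2a)) ∫_{-a}^{a} F dm`, as
`a → +∞` over the reals, exists and equals `c`. -/
def HasInfiniteVolumeAverage {𝕜 : Type*} [RCLike 𝕜] (F : ℝ → 𝕜) (c : 𝕜) : Prop :=
  Tendsto (fun a : ℝ => (1 / (2 * a)) • ∫ x in (-a)..a, F x) atTop (𝓝 c)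

/-- `T` is global-local mixing with respect to Lebesgue measure, for `𝕜`-valued observables:
for every `F ∈ L^∞` whose infinite-volume average exists, with value `c`, and every `g ∈ L^1`,
the functions `(F ∘ T^n) g` are integrable and their integrals converge to `c * ∫ g`. -/
def IsGlobalLocalMixing (𝕜 : Type*) [RCLike 𝕜] (T : ℝ → ℝ) : Prop :=
  ∀ (F : ℝ → 𝕜) (c : 𝕜), MemLp F ⊤ volume → HasInfiniteVolumeAverage F c →
    ∀ g : ℝ → 𝕜, Integrable g volume →
      (∀ n : ℕ, Integrable (fun x => F (T^[n] x) * g x) volume) ∧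
      Tendsto (fun n : ℕ => ∫ x, F (T^[n] x) * g x) atTop (𝓝 (c * ∫ x, g x))

/-! The map extends to `φ(z) = z - 1/z`, which sends the upper half-plane into itself, and its
transfer operator carries the Poisson density `P_z` to `P_{φ(z)}`
(`booleMap_transfer_poissonDensity`). Hence `∫ P_z · (F ∘ T^n) = ∫ P_{φ^n(z)} · F`. Along every
orbit of `φ` the imaginary part tends to infinity and the ratio of real to imaginary part tends to
0, so `P_{φ^n(z)}` becomes a very wide, almost centred kernel. A centred Poisson kernel is a mixture
of normalised indicators of symmetric intervals, so these integrals tend to the infinite-volume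
average.

For general `g`, average `F ∘ T^n` against the Poisson kernel at height `b`. Pointwise convergence
and domination by `M‖g‖` give the limit for each fixed `b`. Undoing the averaging costs at most `M`
times an averaged `L¹` translation modulus of `g`, a bound that is uniform in `n` and vanishes as `b
→ 0` (`norm_integral_mul_sub_poisson_average_le`). -/

/-- The Poisson kernel of the upper half-plane at the point `x + i b`, as a density on the line. -/
noncomputable def poissonDensity (x b y : ℝ) : ℝ := Real.pi⁻¹ * (b / ((y - x) ^ 2 + b ^ 2))

theorem poissonDensity_pos (x y : ℝ) {b : ℝ} (hb : 0 < b) : 0 < poissonDensity x b y := by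
  unfold poissonDensity; positivity

theorem continuous_poissonDensity (x : ℝ) {b : ℝ} (hb : 0 < b) :
    Continuous (poissonDensity x b) := by
  unfold poissonDensity
  refine continuous_const.mul (continuous_const.div (by fun_prop) fun y => ?_)
  positivity

theorem poissonDensity_eq_cauchyPDFReal (x : ℝ) {b : ℝ} (hb : 0 < b) :
    poissonDensity x b = ProbabilityTheory.cauchyPDFReal x ⟨b, hb.le⟩ := by
  ext y
  change Real.pi⁻¹ * (b / ((y - x) ^ 2 + b ^ 2)) = Real.pi⁻¹ * b * ((y - x) ^ 2 + b ^ 2)⁻¹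
  ring

theorem integrable_poissonDensity (x : ℝ) {b : ℝ} (hb : 0 < b) :
    Integrable (poissonDensity x b) := by
  rw [poissonDensity_eq_cauchyPDFReal x hb]
  exact ProbabilityTheory.integrable_cauchyPDFReal x

theorem integral_poissonDensity (x : ℝ) {b : ℝ} (hb : 0 < b) :
    ∫ y, poissonDensity x b y = 1 := by
  rw [poissonDensity_eq_cauchyPDFReal x hb]
  refine ProbabilityTheory.integral_cauchyPDFReal_eq_one x ?_
  intro h
  exact hb.ne' (congrArg NNReal.toReal h)

theorem poissonDensity_affine (x u : ℝ) {b : ℝ} (hb : 0 < b) :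
    poissonDensity x b (x + b * u) = b⁻¹ * poissonDensity 0 1 u := by
  unfold poissonDensity
  have h1 : (x + b * u - x) ^ 2 + b ^ 2 ≠ 0 := by positivity
  have h2 : (u - 0) ^ 2 + 1 ^ 2 ≠ 0 := by positivity
  field_simp
  ring

theorem integral_poissonDensity_smul_affine {E : Type*} [NormedAddCommGroup E] [NormedSpace ℝ E]
    (G : ℝ → E) (x : ℝ) {b : ℝ} (hb : 0 < b) :
    ∫ u, poissonDensity 0 1 u • G (x + b * u) = ∫ y, poissonDensity x b y • G y := by
  have h := Measure.integral_comp_mul_left (fun v => poissonDensity x b (x + v) • G (x + v)) b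
  rw [integral_add_left_eq_self (fun v => poissonDensity x b v • G v) x] at h
  simp only [poissonDensity_affine x _ hb, mul_smul, integral_smul, abs_of_pos (inv_pos.2 hb)] at h
  exact smul_right_injective E (inv_pos.2 hb).ne' h

/-! ### Inverse branches and the transfer operator -/

/-- The inverse branch of `booleMap` with values in the positive half-line. -/
noncomputable def booleBranchPos (x : ℝ) : ℝ := (x + √(x ^ 2 + 4)) / 2

/-- The inverse branch of `booleMap` with values in the negative half-line. -/
noncomputable def booleBranchNeg (x : ℝ) : ℝ := (x - √(x ^ 2 + 4)) / 2

theorem abs_lt_sqrt_sq_add_four (x : ℝ) : |x| < √(x ^ 2 + 4) := by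
  rw [← Real.sqrt_sq_eq_abs]
  exact Real.sqrt_lt_sqrt (sq_nonneg x) (by linarith)

theorem booleBranchPos_pos (x : ℝ) : 0 < booleBranchPos x := by
  have := abs_lt.1 (abs_lt_sqrt_sq_add_four x)
  unfold booleBranchPos; linarith [this.1]

theorem booleBranchNeg_neg (x : ℝ) : booleBranchNeg x < 0 := by
  have := abs_lt.1 (abs_lt_sqrt_sq_add_four x)
  unfold booleBranchNeg; linarith [this.2]

theorem booleBranchPos_mul_neg (x : ℝ) : booleBranchPos x * booleBranchNeg x = -1 := by
  have := Real.sq_sqrt (show 0 ≤ x ^ 2 + 4 by positivity)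
  unfold booleBranchPos booleBranchNeg; linear_combination -this / 4

theorem booleBranchPos_add_neg (x : ℝ) : booleBranchPos x + booleBranchNeg x = x := by
  unfold booleBranchPos booleBranchNeg; ring

theorem booleMap_booleBranchPos (x : ℝ) : booleMap (booleBranchPos x) = x := by
  have h := booleBranchPos_mul_neg x
  have h0 := (booleBranchPos_pos x).ne'
  have : booleBranchNeg x = -(1 / booleBranchPos x) := by field_simp; linarith
  rw [booleMap, sub_eq_add_neg, ← this, booleBranchPos_add_neg]

theorem booleMap_booleBranchNeg (x : ℝ) : booleMap (booleBranchNeg x) = x := by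
  have h := booleBranchPos_mul_neg x
  have h0 := (booleBranchNeg_neg x).ne
  have : booleBranchPos x = -(1 / booleBranchNeg x) := by field_simp; linarith
  rw [booleMap, sub_eq_add_neg, ← this, add_comm, booleBranchPos_add_neg]

theorem booleMap_sq_add_four {y : ℝ} (hy : y ≠ 0) : booleMap y ^ 2 + 4 = (y + 1 / y) ^ 2 := by
  unfold booleMap; field_simp; ring

theorem booleBranchPos_booleMap {y : ℝ} (hy : 0 < y) : booleBranchPos (booleMap y) = y := by
  rw [booleBranchPos, booleMap_sq_add_four hy.ne', Real.sqrt_sq (by positivity), booleMap]; ring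

theorem booleBranchNeg_booleMap {y : ℝ} (hy : y < 0) : booleBranchNeg (booleMap y) = y := by
  have h : 1 / y < 0 := one_div_neg.2 hy
  rw [booleBranchNeg, booleMap_sq_add_four hy.ne, ← neg_sq, Real.sqrt_sq (by linarith), booleMap]
  ring

theorem image_booleBranchPos : booleBranchPos '' Set.univ = Set.Ioi 0 := by
  rw [Set.image_univ]
  ext y
  exact ⟨by rintro ⟨x, rfl⟩; exact booleBranchPos_pos x,
    fun hy => ⟨booleMap y, booleBranchPos_booleMap hy⟩⟩

theorem image_booleBranchNeg : booleBranchNeg '' Set.univ = Set.Iio 0 := by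
  rw [Set.image_univ]
  ext y
  exact ⟨by rintro ⟨x, rfl⟩; exact booleBranchNeg_neg x,
    fun hy => ⟨booleMap y, booleBranchNeg_booleMap hy⟩⟩

theorem hasDerivAt_sqrt_sq_add_four (x : ℝ) :
    HasDerivAt (fun x : ℝ => √(x ^ 2 + 4)) (x / √(x ^ 2 + 4)) x := by
  have h := ((hasDerivAt_pow 2 x).add_const 4).sqrt (by positivity)
  refine h.congr_deriv ?_
  have hs : 0 < √(x ^ 2 + 4) := by positivity
  push_cast
  field_simp

/-- At `y = booleBranchPos x` this is `1 / T'(y)` with `T'(y) = 1 + 1/y²`, cleared of inner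
fractions. -/
theorem hasDerivAt_booleBranchPos (x : ℝ) :
    HasDerivAt booleBranchPos (booleBranchPos x ^ 2 / (booleBranchPos x ^ 2 + 1)) x := by
  have h := ((hasDerivAt_id x).add (hasDerivAt_sqrt_sq_add_four x)).div_const 2
  refine h.congr_deriv ?_
  have hs : 0 < √(x ^ 2 + 4) := by positivity
  have := Real.sq_sqrt (show 0 ≤ x ^ 2 + 4 by positivity)
  have h3 : booleBranchPos x ^ 2 + 1 = √(x ^ 2 + 4) * booleBranchPos x := by
    unfold booleBranchPos; linear_combination -this / 4
  have h0 := booleBranchPos_pos x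
  rw [h3]
  field_simp
  unfold booleBranchPos; ring

theorem hasDerivAt_booleBranchNeg (x : ℝ) :
    HasDerivAt booleBranchNeg (booleBranchNeg x ^ 2 / (booleBranchNeg x ^ 2 + 1)) x := by
  have h := ((hasDerivAt_id x).sub (hasDerivAt_sqrt_sq_add_four x)).div_const 2
  refine h.congr_deriv ?_
  have hs : 0 < √(x ^ 2 + 4) := by positivity
  have := Real.sq_sqrt (show 0 ≤ x ^ 2 + 4 by positivity)
  have h3 : booleBranchNeg x ^ 2 + 1 = -√(x ^ 2 + 4) * booleBranchNeg x := by
    unfold booleBranchNeg; linear_combination -this / 4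
  have h0 := (booleBranchNeg_neg x).ne
  rw [h3]
  field_simp
  unfold booleBranchNeg; ring

/-- The transfer operator of `booleMap` sends the Poisson density at `z = x + i b` to the one
at `z - 1 / z`. -/
theorem booleMap_transfer_poissonDensity (x t : ℝ) {b : ℝ} (hb : 0 < b) :
    booleBranchPos t ^ 2 / (booleBranchPos t ^ 2 + 1) * poissonDensity x b (booleBranchPos t) +
      booleBranchNeg t ^ 2 / (booleBranchNeg t ^ 2 + 1) * poissonDensity x b (booleBranchNeg t) =
      poissonDensity (x * (1 - 1 / (x ^ 2 + b ^ 2))) (b * (1 + 1 / (x ^ 2 + b ^ 2))) t := by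
  have hy := booleBranchPos_pos t
  have h1 := booleBranchPos_mul_neg t
  have h2 := booleBranchPos_add_neg t
  set y := booleBranchPos t
  have hn : booleBranchNeg t = -(1 / y) := by field_simp; linarith
  rw [hn] at h2 ⊢
  rw [← h2]
  unfold poissonDensity
  rw [show y ^ 2 / (y ^ 2 + 1) * (Real.pi⁻¹ * (b / ((y - x) ^ 2 + b ^ 2))) +
      (-(1 / y)) ^ 2 / ((-(1 / y)) ^ 2 + 1) * (Real.pi⁻¹ * (b / ((-(1 / y) - x) ^ 2 + b ^ 2))) =
      Real.pi⁻¹ * (y ^ 2 / (y ^ 2 + 1) * (b / ((y - x) ^ 2 + b ^ 2)) +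
      (-(1 / y)) ^ 2 / ((-(1 / y)) ^ 2 + 1) * (b / ((-(1 / y) - x) ^ 2 + b ^ 2))) by ring]
  congr 1
  have hr : 0 < x ^ 2 + b ^ 2 := by positivity
  have d1 : 0 < (y - x) ^ 2 + b ^ 2 := by positivity
  have d2 : 0 < (1 + y * x) ^ 2 + y ^ 2 * b ^ 2 := by positivity
  have e1 : (-(1 / y)) ^ 2 / ((-(1 / y)) ^ 2 + 1) * (b / ((-(1 / y) - x) ^ 2 + b ^ 2)) =
      y ^ 2 * b / ((y ^ 2 + 1) * ((1 + y * x) ^ 2 + y ^ 2 * b ^ 2)) := by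
    have : (-(1 / y) - x) ^ 2 + b ^ 2 = ((1 + y * x) ^ 2 + y ^ 2 * b ^ 2) / y ^ 2 := by
      field_simp; ring
    rw [this]
    field_simp
    ring
  -- The squared modulus of the factorisation `φ(y) - φ(z) = (y - z)(1 + yz) / (yz)`, with `z = x +
  -- ib`.
  have e2 : (y + -(1 / y) - x * (1 - 1 / (x ^ 2 + b ^ 2))) ^ 2 +
      (b * (1 + 1 / (x ^ 2 + b ^ 2))) ^ 2 =
      ((y - x) ^ 2 + b ^ 2) * ((1 + y * x) ^ 2 + y ^ 2 * b ^ 2) / (y ^ 2 * (x ^ 2 + b ^ 2)) := by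
    field_simp
    ring
  rw [e1, e2]
  field_simp
  ring

/-- Change variables on each half-line through its own inverse branch; the two weighted densities
then add up to the transferred kernel. -/
theorem integral_poissonDensity_smul_comp_booleMap {E : Type*} [NormedAddCommGroup E]
    [NormedSpace ℝ E] {G : ℝ → E} (hG : StronglyMeasurable G) {M : ℝ} (hM : ∀ x, ‖G x‖ ≤ M)
    (x : ℝ) {b : ℝ} (hb : 0 < b) :
    ∫ y, poissonDensity x b y • G (booleMap y) =
      ∫ y, poissonDensity (x * (1 - 1 / (x ^ 2 + b ^ 2))) (b * (1 + 1 / (x ^ 2 + b ^ 2))) y • G y := by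
  have hT : Measurable booleMap := by unfold booleMap; fun_prop
  have hint : Integrable fun y => poissonDensity x b y • G (booleMap y) :=
    (integrable_poissonDensity x hb).smul_bdd M
      (hG.comp_measurable hT).aestronglyMeasurable (.of_forall fun y => hM _)
  have hp := integral_image_eq_integral_abs_deriv_smul MeasurableSet.univ
    (fun t _ => (hasDerivAt_booleBranchPos t).hasDerivWithinAt)
    (Function.LeftInverse.injective booleMap_booleBranchPos).injOn
    (fun y => poissonDensity x b y • G (booleMap y))
  have hn := integral_image_eq_integral_abs_deriv_smul MeasurableSet.univ
    (fun t _ => (hasDerivAt_booleBranchNeg t).hasDerivWithinAt)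
    (Function.LeftInverse.injective booleMap_booleBranchNeg).injOn
    (fun y => poissonDensity x b y • G (booleMap y))
  have hp' := integrableOn_image_iff_integrableOn_abs_deriv_smul MeasurableSet.univ
    (fun t _ => (hasDerivAt_booleBranchPos t).hasDerivWithinAt)
    (Function.LeftInverse.injective booleMap_booleBranchPos).injOn
    (fun y => poissonDensity x b y • G (booleMap y))
  have hn' := integrableOn_image_iff_integrableOn_abs_deriv_smul MeasurableSet.univ
    (fun t _ => (hasDerivAt_booleBranchNeg t).hasDerivWithinAt)
    (Function.LeftInverse.injective booleMap_booleBranchNeg).injOn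
    (fun y => poissonDensity x b y • G (booleMap y))
  rw [image_booleBranchPos] at hp hp'
  rw [image_booleBranchNeg] at hn hn'
  replace hp' := hp'.1 hint.integrableOn
  replace hn' := hn'.1 hint.integrableOn
  simp only [Measure.restrict_univ, integrableOn_univ, booleMap_booleBranchPos,
    booleMap_booleBranchNeg] at hp hn hp' hn'
  rw [← integral_add_compl (measurableSet_Ioi (a := (0 : ℝ))) hint, Set.compl_Ioi,
    integral_Iic_eq_integral_Iio, hp, hn, ← integral_add hp' hn']
  congr 1
  ext t
  rw [abs_of_nonneg (by positivity), abs_of_nonneg (by positivity), smul_smul, smul_smul,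
    ← add_smul, booleMap_transfer_poissonDensity x t hb]

/-- Testing the kernel identity on the indicator of a null set suffices, because a Poisson density
is strictly positive. This is what allows `F` to be changed on a null set inside `F ∘ T^n`. -/
theorem quasiMeasurePreserving_booleMap :
    Measure.QuasiMeasurePreserving booleMap volume volume := by
  have hT : Measurable booleMap := by unfold booleMap; fun_prop
  refine ⟨hT, Measure.AbsolutelyContinuous.mk fun s hs h0 => ?_⟩
  rw [Measure.map_apply hT hs]
  have hm : StronglyMeasurable (s.indicator (fun _ => (1 : ℝ))) :=
    stronglyMeasurable_const.indicator hs
  have hb : ∀ x, ‖s.indicator (fun _ => (1 : ℝ)) x‖ ≤ 1 := fun x =>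
    (norm_indicator_le_norm_self _ _).trans (by simp)
  have key := integral_poissonDensity_smul_comp_booleMap hm hb 0 one_pos
  have hz : s.indicator (fun _ => (1 : ℝ)) =ᵐ[volume] 0 := by
    filter_upwards [measure_eq_zero_iff_ae_notMem.1 h0] with y hy
    exact Set.indicator_of_notMem hy _
  rw [integral_eq_zero_of_ae (f := fun y => poissonDensity (0 * (1 - 1 / (0 ^ 2 + 1 ^ 2)))
      (1 * (1 + 1 / (0 ^ 2 + 1 ^ 2))) y • s.indicator (fun _ => (1 : ℝ)) y)
    (hz.mono fun y hy => by simp only [hy, Pi.zero_apply, smul_zero]),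
    integral_eq_zero_iff_of_nonneg
    (fun y => smul_nonneg (poissonDensity_pos 0 y one_pos).le
      (Set.indicator_nonneg (fun _ _ => zero_le_one) _))
    ((integrable_poissonDensity 0 one_pos).smul_bdd 1 (hm.comp_measurable hT).aestronglyMeasurable
      (.of_forall fun y => hb _))] at key
  refine measure_mono_null (fun y hy => ?_) (ae_iff.1 key)
  simpa [(poissonDensity_pos 0 y one_pos).ne'] using hy

/-! ### Poisson averages and infinite-volume averages -/

/-- The weight expressing `poissonDensity 0 1` as a mixture of indicators of symmetric
intervals. -/
noncomputable def poissonLayer (a : ℝ) : ℝ := Real.pi⁻¹ * (2 * a / (a ^ 2 + 1) ^ 2)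

theorem continuous_poissonLayer : Continuous poissonLayer := by
  unfold poissonLayer
  refine continuous_const.mul (Continuous.div (by fun_prop) (by fun_prop) fun y => ?_)
  positivity

theorem poissonLayer_nonneg {a : ℝ} (ha : 0 ≤ a) : 0 ≤ poissonLayer a := by
  unfold poissonLayer; positivity

theorem hasDerivAt_poissonDensity_zero_one (a : ℝ) :
    HasDerivAt (poissonDensity 0 1) (-poissonLayer a) a := by
  have h := ((((hasDerivAt_pow 2 a).add_const 1).inv (by positivity)).const_mul Real.pi⁻¹)
  have he : poissonDensity 0 1 = fun y => Real.pi⁻¹ * (y ^ 2 + 1)⁻¹ := by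
    ext y; simp [poissonDensity]
  rw [he]
  refine h.congr_deriv ?_
  unfold poissonLayer
  push_cast
  ring

theorem tendsto_poissonDensity_zero_one : Tendsto (poissonDensity 0 1) atTop (𝓝 0) := by
  have he : poissonDensity 0 1 = fun y => Real.pi⁻¹ * (y ^ 2 + 1)⁻¹ := by
    ext y; simp [poissonDensity]
  rw [he, ← mul_zero (Real.pi⁻¹)]
  refine Tendsto.const_mul _ (tendsto_inv_atTop_zero.comp ?_)
  exact tendsto_atTop_add_const_right _ _ (tendsto_pow_atTop two_ne_zero)

theorem integrableOn_poissonLayer {r : ℝ} (hr : 0 ≤ r) :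
    IntegrableOn poissonLayer (Set.Ioi r) := by
  have := integrableOn_Ioi_deriv_of_nonpos' (a := r)
    (fun x _ => hasDerivAt_poissonDensity_zero_one x)
    (fun x hx => neg_nonpos.2 (poissonLayer_nonneg (hr.trans hx.out.le)))
    tendsto_poissonDensity_zero_one
  simpa using this.neg

theorem integral_poissonLayer {r : ℝ} (hr : 0 ≤ r) :
    ∫ a in Set.Ioi r, poissonLayer a = poissonDensity 0 1 r := by
  have := integral_Ioi_of_hasDerivAt_of_nonpos' (a := r)
    (fun x _ => hasDerivAt_poissonDensity_zero_one x)
    (fun x hx => neg_nonpos.2 (poissonLayer_nonneg (hr.trans hx.out.le)))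
    tendsto_poissonDensity_zero_one
  rw [integral_neg] at this
  linarith

theorem poissonDensity_zero_abs (b x : ℝ) : poissonDensity 0 b |x| = poissonDensity 0 b x := by
  simp [poissonDensity]

/-- Layer-cake: the density at `x` is the integral of its negated derivative over `(|x|, ∞)`; then
Fubini. -/
theorem integral_poissonDensity_smul_eq_layers {E : Type*} [NormedAddCommGroup E]
    [NormedSpace ℝ E] [CompleteSpace E] {G : ℝ → E} (hG : StronglyMeasurable G) {M : ℝ}
    (hM : ∀ x, ‖G x‖ ≤ M) :
    ∫ x, poissonDensity 0 1 x • G x =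
      ∫ a in Set.Ioi 0, poissonLayer a • ∫ x in (-a)..a, G x := by
  have hsub : ∀ x : ℝ, Set.Ioi |x| ⊆ Set.Ioi (0 : ℝ) := fun x =>
    Set.Ioi_subset_Ioi (abs_nonneg x)
  have hr : ∀ x : ℝ, (volume.restrict (Set.Ioi (0 : ℝ))).restrict (Set.Ioi |x|) =
      volume.restrict (Set.Ioi |x|) := fun x => Measure.restrict_restrict_of_subset (hsub x)
  have hlay : ∀ x : ℝ, ∫ a in Set.Ioi 0, (Set.Ioi |x|).indicator poissonLayer a =
      poissonDensity 0 1 x := fun x => by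
    rw [integral_indicator measurableSet_Ioi, hr, integral_poissonLayer (abs_nonneg x),
      poissonDensity_zero_abs]
  have hlayi : ∀ x : ℝ, Integrable ((Set.Ioi |x|).indicator poissonLayer)
      (volume.restrict (Set.Ioi 0)) := fun x => by
    rw [integrable_indicator_iff measurableSet_Ioi, IntegrableOn, hr]
    exact integrableOn_poissonLayer (abs_nonneg x)
  have hmeas : AEStronglyMeasurable
      (Function.uncurry fun x a : ℝ => (Set.Ioi |x|).indicator poissonLayer a • G x)
      (volume.prod (volume.restrict (Set.Ioi 0))) := by
    have : (Function.uncurry fun x a : ℝ => (Set.Ioi |x|).indicator poissonLayer a • G x) =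
        {z : ℝ × ℝ | |z.1| < z.2}.indicator (fun z => poissonLayer z.2 • G z.1) := by
      ext ⟨x, a⟩
      by_cases h : |x| < a <;> simp [h]
    rw [this]
    refine StronglyMeasurable.aestronglyMeasurable (StronglyMeasurable.indicator ?_ ?_)
    · exact (continuous_poissonLayer.stronglyMeasurable.comp_measurable measurable_snd).smul
        (hG.comp_measurable measurable_fst)
    · exact measurableSet_lt (by fun_prop) (by fun_prop)
  have hint : Integrable
      (Function.uncurry fun x a : ℝ => (Set.Ioi |x|).indicator poissonLayer a • G x)
      (volume.prod (volume.restrict (Set.Ioi 0))) := by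
    rw [integrable_prod_iff hmeas]
    refine ⟨.of_forall fun x => (hlayi x).smul_const (G x), ?_⟩
    have : (fun x : ℝ => ∫ a in Set.Ioi 0, ‖Function.uncurry
        (fun x a : ℝ => (Set.Ioi |x|).indicator poissonLayer a • G x) (x, a)‖) =
        fun x => poissonDensity 0 1 x • ‖G x‖ := by
      ext x
      rw [← hlay x, smul_eq_mul, ← integral_mul_const]
      congr 1
      ext a
      rw [Function.uncurry_apply_pair, norm_smul, Real.norm_of_nonneg]
      exact Set.indicator_nonneg
        (fun a ha => poissonLayer_nonneg ((abs_nonneg x).trans (le_of_lt ha))) _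
    rw [this]
    exact (integrable_poissonDensity 0 one_pos).smul_bdd M hG.norm.aestronglyMeasurable
      (.of_forall fun x => by simpa using hM x)
  calc ∫ x, poissonDensity 0 1 x • G x
      = ∫ x, ∫ a in Set.Ioi 0, (Set.Ioi |x|).indicator poissonLayer a • G x := by
        congr 1; ext x
        rw [← hlay x, integral_smul_const]
    _ = ∫ a in Set.Ioi 0, ∫ x, (Set.Ioi |x|).indicator poissonLayer a • G x :=
        integral_integral_swap hint
    _ = _ := by
        refine setIntegral_congr_fun measurableSet_Ioi fun a ha => ?_
        have ha' : -a ≤ a := by linarith [ha.out]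
        rw [intervalIntegral.integral_of_le ha', integral_Ioc_eq_integral_Ioo,
          ← integral_indicator measurableSet_Ioo, ← integral_smul]
        congr 1; ext x
        by_cases h : |x| < a
        · simp [h, abs_lt.1 h]
        · have : ¬ (-a < x ∧ x < a) := fun h' => h (abs_lt.2 h')
          simp only [Set.indicator, Set.mem_Ioi, h, Set.mem_Ioo, this, if_false, zero_smul,
            smul_zero]

theorem intervalIntegrable_of_bounded {E : Type*} [NormedAddCommGroup E]
    {G : ℝ → E} (hG : StronglyMeasurable G) {M : ℝ} (hM : ∀ x, ‖G x‖ ≤ M) (a b : ℝ) :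
    IntervalIntegrable G volume a b :=
  (intervalIntegrable_const (c := M)).mono_fun hG.aestronglyMeasurable
    (.of_forall fun x => (hM x).trans (le_abs_self M))

theorem continuous_symmetric_intervalIntegral {E : Type*} [NormedAddCommGroup E]
    [NormedSpace ℝ E] {G : ℝ → E} (hG : StronglyMeasurable G) {M : ℝ} (hM : ∀ x, ‖G x‖ ≤ M) :
    Continuous fun a : ℝ => ∫ x in (-a)..a, G x := by
  have hi := intervalIntegrable_of_bounded hG hM
  have hc := intervalIntegral.continuous_primitive hi 0
  have : (fun a : ℝ => ∫ x in (-a)..a, G x) =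
      fun a => (∫ x in (0 : ℝ)..a, G x) - ∫ x in (0 : ℝ)..(-a), G x := by
    ext a
    rw [intervalIntegral.integral_interval_sub_left (hi _ _) (hi _ _)]
  rw [this]
  exact hc.sub (hc.comp continuous_neg)

theorem integral_poissonLayer_mul : ∫ a in Set.Ioi 0, poissonLayer a * (2 * a) = 1 := by
  -- The layer formula for the constant 1 yields the total mass of the mixture.
  have h := integral_poissonDensity_smul_eq_layers (G := fun _ => (1 : ℝ))
    stronglyMeasurable_const (M := 1) (by simp)
  simp only [smul_eq_mul, mul_one, integral_poissonDensity 0 one_pos,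
    intervalIntegral.integral_const, sub_neg_eq_add] at h
  simpa only [two_mul] using h.symm

/-- The centred Poisson integrals of a bounded function converge to its infinite-volume
average. -/
theorem tendsto_integral_poissonDensity_smul_dilation {E : Type*} [NormedAddCommGroup E]
    [NormedSpace ℝ E] [CompleteSpace E] {F : ℝ → E} (hF : StronglyMeasurable F) {M : ℝ}
    (hM : ∀ x, ‖F x‖ ≤ M) {c : E}
    (hc : Tendsto (fun a : ℝ => (1 / (2 * a)) • ∫ x in (-a)..a, F x) atTop (𝓝 c)) :
    Tendsto (fun y : ℝ => ∫ u, poissonDensity 0 1 u • F (y * u)) atTop (𝓝 c) := by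
  have hlim : ∫ a in Set.Ioi 0, (poissonLayer a * (2 * a)) • c = c := by
    rw [integral_smul_const, integral_poissonLayer_mul, one_smul]
  -- A non-integrable function has Bochner integral 0 by convention, so the value 1 forces
  -- integrability.
  have hwi : IntegrableOn (fun a => poissonLayer a * (2 * a)) (Set.Ioi 0) :=
    Integrable.of_integral_ne_zero (by rw [integral_poissonLayer_mul]; exact one_ne_zero)
  have heq : ∀ y : ℝ, 0 < y → ∫ u, poissonDensity 0 1 u • F (y * u) =
      ∫ a in Set.Ioi 0, (poissonLayer a * (2 * a)) •
        ((1 / (2 * (y * a))) • ∫ x in (-(y * a))..(y * a), F x) := fun y hy => by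
    rw [integral_poissonDensity_smul_eq_layers (G := fun u => F (y * u)) (hF.comp_measurable (measurable_const_mul y))
      (fun x => hM _)]
    refine setIntegral_congr_fun measurableSet_Ioi fun a ha => ?_
    have ha : 0 < a := ha
    rw [intervalIntegral.integral_comp_mul_left F hy.ne', smul_smul, smul_smul, mul_neg]
    congr 1
    field_simp
  refine Tendsto.congr' (f₁ := fun y : ℝ => ∫ a in Set.Ioi 0, (poissonLayer a * (2 * a)) •
        ((1 / (2 * (y * a))) • ∫ x in (-(y * a))..(y * a), F x))
    ((eventually_gt_atTop 0).mono fun y hy => (heq y hy).symm) ?_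
  rw [← hlim]
  refine tendsto_integral_filter_of_dominated_convergence
    (fun a => (poissonLayer a * (2 * a)) * M) (.of_forall fun y => ?_) ?_
    (hwi.mul_const M) ?_
  · refine StronglyMeasurable.aestronglyMeasurable (StronglyMeasurable.smul ?_
      (StronglyMeasurable.smul ?_ ?_))
    · exact (continuous_poissonLayer.mul (by fun_prop)).stronglyMeasurable
    · exact Measurable.stronglyMeasurable (by fun_prop)
    · exact ((continuous_symmetric_intervalIntegral hF hM).comp
        (continuous_const_mul y)).stronglyMeasurable
  · filter_upwards [eventually_gt_atTop 0] with y hy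
    refine (ae_restrict_iff' measurableSet_Ioi).2 (.of_forall fun a ha => ?_)
    have ha : 0 < a := ha
    have hya : 0 < y * a := mul_pos hy ha
    rw [norm_smul, Real.norm_of_nonneg (mul_nonneg (poissonLayer_nonneg ha.le) (by positivity))]
    refine mul_le_mul_of_nonneg_left ?_ (mul_nonneg (poissonLayer_nonneg ha.le) (by positivity))
    have hb := intervalIntegral.norm_integral_le_of_norm_le_const (a := -(y * a)) (b := y * a)
      (f := F) (C := M) fun x _ => hM x
    rw [norm_smul, Real.norm_of_nonneg (by positivity), one_div, inv_mul_le_iff₀ (by positivity)]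
    refine hb.trans_eq ?_
    rw [abs_of_pos (by linarith)]
    ring
  · refine (ae_restrict_iff' measurableSet_Ioi).2 (.of_forall fun a ha => ?_)
    exact (hc.comp (tendsto_id.atTop_mul_const ha)).const_smul _

/-- Continuity of translation in `L¹`, read off from the continuous action of `ℝ` on `Lp`. -/
theorem continuous_integral_norm_translate_sub {E : Type*} [NormedAddCommGroup E]
    {g : ℝ → E} (hg : Integrable g) : Continuous fun h : ℝ => ∫ x, ‖g (h + x) - g x‖ := by
  have hm := memLp_one_iff_integrable.2 hg
  have : Fact ((1 : ENNReal) ≠ ⊤) := ⟨ENNReal.one_ne_top⟩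
  have hcont : Continuous fun h : ℝ => ‖(DomAddAct.mk h +ᵥ hm.toLp g) - hm.toLp g‖ :=
    ((DomAddAct.continuous_mk.vadd continuous_const).sub continuous_const).norm
  refine hcont.congr fun h => ?_
  rw [L1.norm_eq_integral_norm]
  refine integral_congr_ae ?_
  filter_upwards [Lp.coeFn_sub (DomAddAct.mk h +ᵥ hm.toLp g) (hm.toLp g),
    DomAddAct.vadd_Lp_ae_eq (DomAddAct.mk h) (hm.toLp g), hm.coeFn_toLp,
    (measurePreserving_vadd h (volume : Measure ℝ)).quasiMeasurePreserving.ae hm.coeFn_toLp]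
    with x h1 h2 h3 h4
  rw [h1, Pi.sub_apply, h2, h3]
  simp only [vadd_eq_add] at h4
  simp [h4]

/-- After rescaling by `y`, being off centre is a translation of the unit kernel by `x / y → 0`,
which costs at most `M` times its `L¹` translation modulus. -/
theorem tendsto_integral_poissonDensity_smul_affine {ι E : Type*} [NormedAddCommGroup E]
    [NormedSpace ℝ E] [CompleteSpace E] {F : ℝ → E} (hF : StronglyMeasurable F) {M : ℝ}
    (hM : ∀ x, ‖F x‖ ≤ M) {c : E}
    (hc : Tendsto (fun a : ℝ => (1 / (2 * a)) • ∫ x in (-a)..a, F x) atTop (𝓝 c))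
    {l : Filter ι} {x y : ι → ℝ} (hy : Tendsto y l atTop)
    (hxy : Tendsto (fun i => x i / y i) l (𝓝 0)) :
    Tendsto (fun i => ∫ u, poissonDensity 0 1 u • F (x i + y i * u)) l (𝓝 c) := by
  have h1 := (tendsto_integral_poissonDensity_smul_dilation hF hM hc).comp hy
  have hp := integrable_poissonDensity 0 one_pos
  have hω := (continuous_integral_norm_translate_sub hp).tendsto 0
  simp only [zero_add, sub_self, norm_zero, integral_zero] at hω
  have hω' := (hω.comp (by simpa using hxy.neg : Tendsto (fun i => -(x i / y i)) l (𝓝 0))).const_mul M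
  rw [mul_zero] at hω'
  refine (tendsto_iff_of_dist ?_).1 h1
  refine squeeze_zero' (.of_forall fun _ => dist_nonneg) ?_ hω'
  filter_upwards [hy.eventually (eventually_gt_atTop 0)] with i hi
  have hi' : ∀ r : ℝ, ∀ z, Integrable fun u => poissonDensity 0 1 (z + u) • F (r * u) :=
    fun r z => (hp.comp_add_left z).smul_bdd M
      (hF.comp_measurable (measurable_const_mul r)).aestronglyMeasurable (.of_forall fun u => hM _)
  have h2 : ∫ u, poissonDensity 0 1 u • F (x i + y i * u) =
      ∫ u, poissonDensity 0 1 (-(x i / y i) + u) • F (y i * u) := by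
    rw [← integral_add_left_eq_self _ (-(x i / y i))]
    congr 1; ext u
    congr 2
    field_simp
    ring
  have h3 : Integrable fun u => poissonDensity 0 1 u • F (y i * u) := by simpa using hi' (y i) 0
  rw [h2, dist_comm, dist_eq_norm, Function.comp_apply, ← integral_sub (hi' _ _) h3,
    Function.comp_apply, ← integral_const_mul]
  refine norm_integral_le_of_norm_le (((hp.comp_add_left _).sub hp).norm.const_mul M)
    (.of_forall fun u => ?_)
  rw [← sub_smul, norm_smul, mul_comm]
  exact mul_le_mul_of_nonneg_right (hM _) (norm_nonneg _)

/-! ### Dynamics on the upper half-plane -/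

/-- The action `z ↦ z - 1 / z` of the Boole map on the upper half-plane, in real coordinates. -/
noncomputable def halfPlaneBoole (z : ℝ × ℝ) : ℝ × ℝ :=
  (z.1 * (1 - 1 / (z.1 ^ 2 + z.2 ^ 2)), z.2 * (1 + 1 / (z.1 ^ 2 + z.2 ^ 2)))

theorem halfPlaneBoole_snd_pos {z : ℝ × ℝ} (hz : 0 < z.2) : 0 < (halfPlaneBoole z).2 := by
  unfold halfPlaneBoole; positivity

theorem halfPlaneBoole_iterate_snd_pos {z : ℝ × ℝ} (hz : 0 < z.2) (n : ℕ) :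
    0 < (halfPlaneBoole^[n] z).2 := by
  induction n with
  | zero => exact hz
  | succ n ih => rw [Function.iterate_succ_apply']; exact halfPlaneBoole_snd_pos ih

/-- Cones about the imaginary axis are invariant, since `|1 - s| ≤ 1 + s` for `s = 1/|z|²`. -/
theorem halfPlaneBoole_abs_fst_le {z : ℝ × ℝ} (hz : 0 < z.2) {t : ℝ} (ht : |z.1| ≤ t * z.2) :
    |(halfPlaneBoole z).1| ≤ t * (halfPlaneBoole z).2 := by
  have hr : 0 < 1 / (z.1 ^ 2 + z.2 ^ 2) := by positivity
  simp only [halfPlaneBoole, abs_mul]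
  have h1 : |1 - 1 / (z.1 ^ 2 + z.2 ^ 2)| ≤ 1 + 1 / (z.1 ^ 2 + z.2 ^ 2) :=
    abs_le.2 ⟨by linarith, by linarith⟩
  rw [← mul_assoc]
  exact mul_le_mul ht h1 (abs_nonneg _) ((abs_nonneg _).trans ht)

/-- In the cone `(Im z)² / |z|² ≥ 1 / (t² + 1)`, and the cross term of the expanded square
contributes twice this. The fixed gain per step makes heights grow at least like `√n`. -/
theorem halfPlaneBoole_snd_sq_ge {z : ℝ × ℝ} (hz : 0 < z.2) {t : ℝ} (ht : |z.1| ≤ t * z.2) :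
    z.2 ^ 2 + 2 / (t ^ 2 + 1) ≤ (halfPlaneBoole z).2 ^ 2 := by
  have hr : z.1 ^ 2 + z.2 ^ 2 ≤ (t ^ 2 + 1) * z.2 ^ 2 := by
    have := pow_le_pow_left₀ (abs_nonneg _) ht 2
    rw [sq_abs] at this
    linarith [mul_pow t z.2 2]
  have h0 : 0 < z.1 ^ 2 + z.2 ^ 2 := by positivity
  have h1 : 1 / (t ^ 2 + 1) ≤ z.2 ^ 2 * (1 / (z.1 ^ 2 + z.2 ^ 2)) := by
    rw [mul_one_div, div_le_div_iff₀ (by positivity) h0]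
    linarith
  have h2 : 0 ≤ z.2 ^ 2 * (1 / (z.1 ^ 2 + z.2 ^ 2)) ^ 2 := by positivity
  have h3 : (2 : ℝ) / (t ^ 2 + 1) = 2 * (1 / (t ^ 2 + 1)) := by ring
  simp only [halfPlaneBoole]
  rw [h3]
  linarith [show (z.2 * (1 + 1 / (z.1 ^ 2 + z.2 ^ 2))) ^ 2 = z.2 ^ 2 +
    2 * (z.2 ^ 2 * (1 / (z.1 ^ 2 + z.2 ^ 2))) + z.2 ^ 2 * (1 / (z.1 ^ 2 + z.2 ^ 2)) ^ 2 by ring]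

theorem tendsto_halfPlaneBoole_iterate_snd {z : ℝ × ℝ} (hz : 0 < z.2) :
    Tendsto (fun n => (halfPlaneBoole^[n] z).2) atTop atTop := by
  set t := |z.1| / z.2
  have ht : ∀ n, |(halfPlaneBoole^[n] z).1| ≤ t * (halfPlaneBoole^[n] z).2 := fun n => by
    induction n with
    | zero => exact (div_mul_cancel₀ _ hz.ne').ge
    | succ n ih =>
      rw [Function.iterate_succ_apply']
      exact halfPlaneBoole_abs_fst_le (halfPlaneBoole_iterate_snd_pos hz n) ih
  have hsq : ∀ n : ℕ, n * (2 / (t ^ 2 + 1)) ≤ (halfPlaneBoole^[n] z).2 ^ 2 := fun n => by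
    induction n with
    | zero => simpa using sq_nonneg z.2
    | succ n ih =>
      rw [Function.iterate_succ_apply']
      refine le_trans ?_ (halfPlaneBoole_snd_sq_ge (halfPlaneBoole_iterate_snd_pos hz n) (ht n))
      push_cast
      linarith
  have h1 : Tendsto (fun n : ℕ => √(n * (2 / (t ^ 2 + 1)))) atTop atTop :=
    Real.tendsto_sqrt_atTop.comp
      (tendsto_natCast_atTop_atTop.atTop_mul_const (by positivity))
  exact tendsto_atTop_mono (fun n => Real.sqrt_le_iff.2
    ⟨(halfPlaneBoole_iterate_snd_pos hz n).le, hsq n⟩) h1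

theorem tendsto_halfPlaneBoole_iterate_div {z : ℝ × ℝ} (hz : 0 < z.2) :
    Tendsto (fun n => (halfPlaneBoole^[n] z).1 / (halfPlaneBoole^[n] z).2) atTop (𝓝 0) := by
  have hy := tendsto_halfPlaneBoole_iterate_snd hz
  obtain ⟨N, hN⟩ := eventually_atTop.1 (hy.eventually (eventually_ge_atTop 1))
  -- Once the height is at least 1, `1/|z|² ≤ 1`, so the factor multiplying the real part lies in
  -- `[0, 1]`.
  have hx : ∀ n, N ≤ n → |(halfPlaneBoole^[n] z).1| ≤ |(halfPlaneBoole^[N] z).1| := fun n hn => by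
    induction n, hn using Nat.le_induction with
    | base => exact le_rfl
    | succ n hn ih =>
      rw [Function.iterate_succ_apply']
      refine le_trans ?_ ih
      have h1 := hN n hn
      set w := halfPlaneBoole^[n] z
      have h2 : 1 ≤ w.1 ^ 2 + w.2 ^ 2 := by
        have := one_le_pow₀ h1 (n := 2)
        linarith [sq_nonneg w.1]
      have h3 : 0 < 1 / (w.1 ^ 2 + w.2 ^ 2) := by positivity
      have h4 : 1 / (w.1 ^ 2 + w.2 ^ 2) ≤ 1 := (div_le_one (by positivity)).2 h2
      simp only [halfPlaneBoole, abs_mul]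
      exact mul_le_of_le_one_right (abs_nonneg _) (abs_le.2 ⟨by linarith, by linarith⟩)
  refine squeeze_zero_norm' ?_ (hy.const_div_atTop |(halfPlaneBoole^[N] z).1|)
  filter_upwards [eventually_ge_atTop N] with n hn
  have hp := halfPlaneBoole_iterate_snd_pos hz n
  rw [norm_div, Real.norm_of_nonneg hp.le]
  exact div_le_div_of_nonneg_right (hx n hn) hp.le

/-! ### Convergence for iterates and passage to general `g` -/

theorem measurable_booleMap : Measurable booleMap := quasiMeasurePreserving_booleMap.measurable

theorem integral_poissonDensity_smul_comp_booleMap_iterate {E : Type*} [NormedAddCommGroup E]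
    [NormedSpace ℝ E] {F : ℝ → E} (hF : StronglyMeasurable F) {M : ℝ} (hM : ∀ x, ‖F x‖ ≤ M)
    (n : ℕ) {z : ℝ × ℝ} (hz : 0 < z.2) :
    ∫ y, poissonDensity z.1 z.2 y • F (booleMap^[n] y) =
      ∫ y, poissonDensity (halfPlaneBoole^[n] z).1 (halfPlaneBoole^[n] z).2 y • F y := by
  induction n generalizing z with
  | zero => rfl
  | succ n ih =>
    rw [Function.iterate_succ_apply, ← ih (halfPlaneBoole_snd_pos hz)]
    exact integral_poissonDensity_smul_comp_booleMap
      (G := fun y => F (booleMap^[n] y))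
      (hF.comp_measurable (measurable_booleMap.iterate n)) (fun _ => hM _) z.1 hz

theorem tendsto_integral_poissonDensity_smul_booleMap_iterate {E : Type*} [NormedAddCommGroup E]
    [NormedSpace ℝ E] [CompleteSpace E] {F : ℝ → E} (hF : StronglyMeasurable F) {M : ℝ}
    (hM : ∀ x, ‖F x‖ ≤ M) {c : E}
    (hc : Tendsto (fun a : ℝ => (1 / (2 * a)) • ∫ x in (-a)..a, F x) atTop (𝓝 c))
    (x : ℝ) {b : ℝ} (hb : 0 < b) :
    Tendsto (fun n => ∫ u, poissonDensity 0 1 u • F (booleMap^[n] (x + b * u))) atTop (𝓝 c) := by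
  have hz : 0 < ((x, b) : ℝ × ℝ).2 := hb
  refine (tendsto_integral_poissonDensity_smul_affine hF hM hc
    (tendsto_halfPlaneBoole_iterate_snd hz) (tendsto_halfPlaneBoole_iterate_div hz)).congr
    fun n => ?_
  rw [integral_poissonDensity_smul_affine F _ (halfPlaneBoole_iterate_snd_pos hz n),
    integral_poissonDensity_smul_affine (fun y => F (booleMap^[n] y)) x hb,
    integral_poissonDensity_smul_comp_booleMap_iterate hF hM n hz]

theorem norm_integral_norm_translate_sub_le {E : Type*} [NormedAddCommGroup E]
    {g : ℝ → E} (hg : Integrable g) (h : ℝ) :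
    ‖∫ x, ‖g (h + x) - g x‖‖ ≤ (∫ x, ‖g x‖) + ∫ x, ‖g x‖ := by
  have hgt := hg.comp_add_left h
  rw [Real.norm_of_nonneg (integral_nonneg fun _ => norm_nonneg _)]
  calc ∫ x, ‖g (h + x) - g x‖ ≤ ∫ x, (‖g (h + x)‖ + ‖g x‖) :=
        integral_mono (hgt.sub hg).norm (hgt.norm.add hg.norm) fun x => norm_sub_le _ _
    _ = _ := by
        rw [integral_add hgt.norm hg.norm, integral_add_left_eq_self (fun x => ‖g x‖) h]

/-- Dominated convergence: the modulus is continuous, vanishes at 0 and never exceeds `2‖g‖₁`. -/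
theorem tendsto_integral_poissonDensity_mul_translate {E : Type*} [NormedAddCommGroup E]
    {g : ℝ → E} (hg : Integrable g) :
    Tendsto (fun b : ℝ => ∫ u, poissonDensity 0 1 u * ∫ x, ‖g (-(b * u) + x) - g x‖) (𝓝 0)
      (𝓝 0) := by
  have hω := continuous_integral_norm_translate_sub hg
  suffices h : Tendsto (fun b : ℝ => ∫ u, poissonDensity 0 1 u * ∫ x, ‖g (-(b * u) + x) - g x‖)
      (𝓝 0) (𝓝 (∫ u : ℝ, poissonDensity 0 1 u * 0)) by
    simpa only [mul_zero, integral_zero] using h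
  refine tendsto_integral_filter_of_dominated_convergence
    (fun u => poissonDensity 0 1 u * ((∫ x, ‖g x‖) + ∫ x, ‖g x‖)) (.of_forall fun b => ?_)
    (.of_forall fun b => .of_forall fun u => ?_)
    ((integrable_poissonDensity 0 one_pos).mul_const _) (.of_forall fun u => ?_)
  · exact ((continuous_poissonDensity 0 one_pos).mul
      (hω.comp (by fun_prop : Continuous fun u => -(b * u)))).aestronglyMeasurable
  · have hp := (poissonDensity_pos 0 u one_pos).le
    rw [norm_mul, Real.norm_of_nonneg hp]
    exact mul_le_mul_of_nonneg_left (norm_integral_norm_translate_sub_le hg _) hp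
  · have h1 : Tendsto (fun b : ℝ => -(b * u)) (𝓝 0) (𝓝 0) := by
      have : Continuous fun b : ℝ => -(b * u) := by fun_prop
      simpa using this.tendsto 0
    have h2 := (hω.tendsto 0).comp h1
    simp only [zero_add, sub_self, norm_zero, integral_zero] at h2
    exact h2.const_mul _

/-- Replacing `g` by its Poisson average at scale `b` changes the integral against a bounded
function by at most the averaged `L¹` modulus of continuity of `g`. -/
theorem norm_integral_mul_sub_poisson_average_le {𝕜 : Type*} [RCLike 𝕜] {H : ℝ → 𝕜}
    (hH : StronglyMeasurable H) {M : ℝ} (hM : ∀ x, ‖H x‖ ≤ M) {g : ℝ → 𝕜} (hg : Integrable g)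
    (b : ℝ) :
    ‖(∫ x, (∫ u, poissonDensity 0 1 u • H (x + b * u)) * g x) - ∫ x, H x * g x‖ ≤
      M * ∫ u, poissonDensity 0 1 u * ∫ x, ‖g (-(b * u) + x) - g x‖ := by
  have hp := integrable_poissonDensity 0 one_pos
  have hω := continuous_integral_norm_translate_sub hg
  have hHg : ∀ {f : ℝ → 𝕜}, Integrable f → Integrable fun x => H x * f x := fun hf =>
    hf.bdd_mul hH.aestronglyMeasurable (.of_forall hM)
  have hint : Integrable (Function.uncurry fun x u : ℝ =>
      poissonDensity 0 1 u • (H (x + b * u) * g x)) (volume.prod volume) := by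
    have h1 : Integrable (fun z : ℝ × ℝ => poissonDensity 0 1 z.2 • g z.1)
        (volume.prod volume) := by
      have := (hp.smul_prod hg).swap
      exact this
    have h2 : StronglyMeasurable fun z : ℝ × ℝ => H (z.1 + b * z.2) :=
      hH.comp_measurable (by fun_prop)
    have h3 := h1.bdd_mul h2.aestronglyMeasurable (.of_forall fun z => hM _)
    refine h3.congr (.of_forall fun z => ?_)
    simp only [Function.uncurry, mul_smul_comm]
  -- Translation invariance moves the shift from `H`, of which only a bound is known, onto `g`.
  have htr : ∀ u : ℝ, ∫ x, poissonDensity 0 1 u • (H (x + b * u) * g x) =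
      poissonDensity 0 1 u • ∫ x, H x * g (-(b * u) + x) := fun u => by
    rw [integral_smul, ← integral_add_left_eq_self (fun x => H x * g (-(b * u) + x)) (b * u)]
    congr 2; ext x
    rw [neg_add_cancel_left, add_comm]
  have h1 : (∫ x, (∫ u, poissonDensity 0 1 u • H (x + b * u)) * g x) =
      ∫ u, poissonDensity 0 1 u • ∫ x, H x * g (-(b * u) + x) := by
    calc (∫ x, (∫ u, poissonDensity 0 1 u • H (x + b * u)) * g x)
        = ∫ x, ∫ u, poissonDensity 0 1 u • (H (x + b * u) * g x) := by
          congr 1; ext x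
          rw [← integral_mul_const]
          simp only [smul_mul_assoc]
      _ = ∫ u, ∫ x, poissonDensity 0 1 u • (H (x + b * u) * g x) := integral_integral_swap hint
      _ = _ := integral_congr_ae (.of_forall htr)
  have h2 : ∫ x, H x * g x = ∫ u, poissonDensity 0 1 u • ∫ x, H x * g x := by
    rw [integral_smul_const, integral_poissonDensity 0 one_pos, one_smul]
  have hi1 : Integrable fun u => poissonDensity 0 1 u • ∫ x, H x * g (-(b * u) + x) :=
    hint.integral_prod_right.congr (.of_forall htr)
  rw [h1, h2, ← integral_sub hi1 (hp.smul_const _), ← integral_const_mul]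
  have hgi : ∀ u : ℝ, Integrable fun x => g (-(b * u) + x) := fun u => hg.comp_add_left _
  refine norm_integral_le_of_norm_le ((hp.mul_bdd
    (hω.comp (by fun_prop : Continuous fun u => -(b * u))).aestronglyMeasurable
    (.of_forall fun u => norm_integral_norm_translate_sub_le hg _)).const_mul M) (.of_forall fun u => ?_)
  have hpu := (poissonDensity_pos 0 u one_pos).le
  rw [← smul_sub, norm_smul, Real.norm_of_nonneg hpu, mul_left_comm]
  refine mul_le_mul_of_nonneg_left ?_ hpu
  rw [← integral_sub (hHg (hgi u)) (hHg hg), ← integral_const_mul]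
  refine norm_integral_le_of_norm_le (((hgi u).sub hg).norm.const_mul M) (.of_forall fun x => ?_)
  rw [← mul_sub, norm_mul]
  exact mul_le_mul_of_nonneg_right (hM _) (norm_nonneg _)

theorem tendsto_integral_comp_booleMap_iterate_mul {𝕜 : Type*} [RCLike 𝕜] {F : ℝ → 𝕜}
    (hF : StronglyMeasurable F) {M : ℝ} (hM : ∀ x, ‖F x‖ ≤ M) {c : 𝕜}
    (hc : HasInfiniteVolumeAverage F c) {g : ℝ → 𝕜} (hg : Integrable g) :
    Tendsto (fun n : ℕ => ∫ x, F (booleMap^[n] x) * g x) atTop (𝓝 (c * ∫ x, g x)) := by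
  have hp := integrable_poissonDensity 0 one_pos
  have hFn : ∀ n : ℕ, StronglyMeasurable fun x => F (booleMap^[n] x) := fun n =>
    hF.comp_measurable (measurable_booleMap.iterate n)
  have havg : ∀ b : ℝ, 0 < b → Tendsto (fun n : ℕ =>
      ∫ x, (∫ u, poissonDensity 0 1 u • F (booleMap^[n] (x + b * u))) * g x) atTop
      (𝓝 (c * ∫ x, g x)) := fun b hb => by
    rw [← integral_const_mul]
    refine tendsto_integral_of_dominated_convergence (fun x => M * ‖g x‖) (fun n => ?_)
      (hg.norm.const_mul M) (fun n => .of_forall fun x => ?_) (.of_forall fun x => ?_)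
    · refine AEStronglyMeasurable.mul (StronglyMeasurable.aestronglyMeasurable ?_)
        hg.aestronglyMeasurable
      refine StronglyMeasurable.integral_prod_right
        (f := fun x u : ℝ => poissonDensity 0 1 u • F (booleMap^[n] (x + b * u))) ?_
      exact ((continuous_poissonDensity 0 one_pos).stronglyMeasurable.comp_measurable
        measurable_snd).smul ((hFn n).comp_measurable (by fun_prop : Measurable
          fun z : ℝ × ℝ => z.1 + b * z.2))
    · rw [norm_mul]
      refine mul_le_mul_of_nonneg_right ?_ (norm_nonneg _)
      refine (norm_integral_le_of_norm_le (hp.mul_const M) (.of_forall fun u => ?_)).trans_eq ?_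
      · have hpu := (poissonDensity_pos 0 u one_pos).le
        rw [norm_smul, Real.norm_of_nonneg hpu]
        exact mul_le_mul_of_nonneg_left (hM _) hpu
      · rw [integral_mul_const, integral_poissonDensity 0 one_pos, one_mul]
    · exact (tendsto_integral_poissonDensity_smul_booleMap_iterate hF hM hc x hb).mul_const _
  have hδ := (tendsto_integral_poissonDensity_mul_translate hg).const_mul M
  rw [mul_zero] at hδ
  rw [Metric.tendsto_atTop]
  intro ε hε
  -- The scale `b` is fixed before `N`: the averaging error does not depend on `n`.
  obtain ⟨b, hb, hb0⟩ := (((hδ.mono_left nhdsWithin_le_nhds).eventually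
    (gt_mem_nhds (half_pos hε))).and (self_mem_nhdsWithin (s := Set.Ioi (0 : ℝ)))).exists
  obtain ⟨N, hN⟩ := Metric.tendsto_atTop.1 (havg b hb0) (ε / 2) (half_pos hε)
  refine ⟨N, fun n hn => ?_⟩
  have h1 := norm_integral_mul_sub_poisson_average_le (hFn n) (fun x => hM _) hg b
  rw [← dist_eq_norm, dist_comm] at h1
  linarith [dist_triangle (∫ x, F (booleMap^[n] x) * g x)
    (∫ x, (∫ u, poissonDensity 0 1 u • F (booleMap^[n] (x + b * u))) * g x) (c * ∫ x, g x),
    hN n hn]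

/-- An essentially bounded function has a bounded strongly measurable representative. -/
theorem exists_stronglyMeasurable_bounded_ae_eq {α E : Type*} [MeasurableSpace α]
    [NormedAddCommGroup E] {μ : Measure α} {F : α → E} (hF : MemLp F ⊤ μ) :
    ∃ (G : α → E) (M : ℝ), StronglyMeasurable G ∧ (∀ x, ‖G x‖ ≤ M) ∧ F =ᵐ[μ] G := by
  have hm := hF.1.stronglyMeasurable_mk
  set M := (eLpNorm F ⊤ μ).toReal
  refine ⟨{x | ‖hF.1.mk F x‖ ≤ M}.indicator (hF.1.mk F), M,
    hm.indicator (measurableSet_le hm.norm.measurable measurable_const), fun x => ?_, ?_⟩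
  · by_cases h : ‖hF.1.mk F x‖ ≤ M
    · simp [Set.indicator, h]
    · simp only [Set.indicator, Set.mem_ofPred_eq, h, if_false, norm_zero]
      exact ENNReal.toReal_nonneg
  · filter_upwards [hF.1.ae_eq_mk, ae_le_eLpNormEssSup (f := F) (μ := μ)] with x h1 h2
    have h3 : ‖F x‖ ≤ M := by
      rw [← toReal_enorm]
      exact ENNReal.toReal_mono hF.2.ne (by rwa [eLpNorm_exponent_top])
    rw [h1] at h3 ⊢
    exact (Set.indicator_of_mem (s := {x | ‖hF.1.mk F x‖ ≤ M}) h3 _).symm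

theorem theorem2p7 (𝕜 : Type*) [RCLike 𝕜] : IsGlobalLocalMixing 𝕜 booleMap := by
  intro F c hF hc g hg
  obtain ⟨G, M, hG, hM, hFG⟩ := exists_stronglyMeasurable_bounded_ae_eq hF
  have hae : ∀ n : ℕ, (fun x => G (booleMap^[n] x) * g x) =ᵐ[volume]
      fun x => F (booleMap^[n] x) * g x := fun n => by
    filter_upwards [(quasiMeasurePreserving_booleMap.iterate n).ae hFG] with x hx
    rw [hx]
  have hcG : HasInfiniteVolumeAverage G c := by
    refine hc.congr fun a => ?_
    rw [intervalIntegral.integral_congr_ae (hFG.mono fun x hx _ => hx)]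
  refine ⟨fun n => ?_, (tendsto_integral_comp_booleMap_iterate_mul hG hM hcG hg).congr
    fun n => integral_congr_ae (hae n)⟩
  exact (hg.bdd_mul (hG.comp_measurable (measurable_booleMap.iterate n)).aestronglyMeasurable
    (.of_forall fun x => hM _)).congr (hae n)
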